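/- **Setting.** A *family of rooted trees* $\mathcal T$ is a collection of finite rooted trees (members may carry extra structure, such as an order on the children or labels), with finitely many members of each size. For a member $t$ let $|t|$ be its number of vertices, $r(t)$ its root, and $d(v,r(t))$ the number of edges in the path from $v$ to $r(t)$; a leaf is a vertex without children (the vertex of a one-vertex tree is a leaf). *Grafting* a tree $u$ on a tree $s$ at a leaf $\ell$ of $s$ means removing $\ell$ and placing $u$ there as a subtree. The family $\mathcal T$ is *graftable* if grafting is a bijection from the set of triples $(s,\ell,u)$, with $s,u\in\mathcal T$ and $\ell$ a leaf of $s$, onto the set of pairs $(t,v)$, with $t\in\mathcal T$ and $v$ a vertex of $t$; that is, there is a bijection $(s,\ell,u)\mapsto(t,v)$ such that, as a rooted tree, $t$ is the result of grafting $u$ on $s$ at $\ell$, the root of $u$ being placed at $v$. A family of labelled trees (the vertices of $t$ carry the labels $0,\dots,|t|-1$) is *graftable* if there is such a correspondence from the quadruples $(s,\ell,u,W)$, where $W$ is a $|u|$-element set of labels in $\{0,\dots,|s|+|u|-2\}$, to the pairs $(t,v)$, where $W$ is the set of labels of the subtree in $t$, the relative order of the labels is kept within $u$ and within $s\setminus\{\ell\}$,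 and each $(t,v)$ arises exactly once for each label that $\ell$ can have in $s$, i.e. for each element of $\{0,\dots,|s|-1\}$, where $|s|$ is $|t|+1$ minus the number of vertices of the subtree of $t$ rooted at $v$. Put $\omega_n=1$ for (unlabelled) families and $\omega_n=1/n!$ for families of labelled trees, and let $$T(x)=\sum_{t\in\mathcal T}\omega_{|t|}x^{|t|},\quad V(x)=\sum_{t\in\mathcal T}|t|\,\omega_{|t|}x^{|t|},\quad L(x)=\sum_{t\in\mathcal T}\#\{\text{leaves of }t\}\,\omega_{|t|}x^{|t|},$$ $$D_k(x)=\sum_{t\in\mathcal T}\sum_{v\in t}d(v,r(t))^k\,\omega_{|t|}x^{|t|}.$$ **Theorem.** There are polynomials $P_k,Q_k\in\mathbb Q[y]$, $k\ge 0$, depending only on $k$, with $P_0=1$, $Q_0=Q_1=0$, $$P_k(y)=k!\,y^k-\frac{k!\,(k-1)}{2}\,y^{k-1}+Q_k(y)\qquad(k\ge 1),$$ where $Q_2$ is constant and $Q_k$ has degree exactly $k-2$ for $k\ge 3$, such that the following holds. Let $\mathcal T$ be a graftable family of trees (with $\omega_n=1$) or a graftable family of labelled trees (with $\omega_n=1/n!$),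 and suppose that $T(x)=x\,\Phi(T(x))$ for some formal power series $\Phi\in\mathbb Q[[y]]$. Then, as formal power series, $$D_k(x)=\bigl(V(x)-T(x)\bigr)\,P_k\!\left(\frac{L(x)}{x}\right)\qquad\text{for all }k\ge 1,$$ and for $k=0$ the same identity holds if the roots are not counted: $D_0(x)-T(x)=(V(x)-T(x))\,P_0(L(x)/x)$ (with $0^0=1$ in $D_0$). -/

import Mathlib

open scoped PowerSeries

universe u v

/-- A family of finite rooted trees: an indexed collection of trees, each of them a finite
connected acyclic graph with a distinguished vertex, with finitely many members of each size.
Distinct indices count as distinct members, so the members may carry additional structure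
(an order on the children, left and right children, labels, ...) which is recorded by the index. -/
structure TreeFamily where
  /-- the set of members of the family -/
  Idx : Type u
  /-- the vertices of a member -/
  Vert : Idx → Type v
  [fintypeVert : ∀ a, Fintype (Vert a)]
  /-- the underlying graph of a member -/
  graph : ∀ a, SimpleGraph (Vert a)
  isTree : ∀ a, (graph a).IsTree
  /-- the root of a member -/
  root : ∀ a, Vert a
  finite_size : ∀ n : ℕ, {a : Idx | Fintype.card (Vert a) = n}.Finite

namespace TreeFamily

attribute [instance] TreeFamily.fintypeVert

variable (F : TreeFamily.{u, v})

/-- The number of vertices of a member. -/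
def size (a : F.Idx) : ℕ := Fintype.card (F.Vert a)

/-- `d(v, r)`: the number of edges in the path between the vertex `v` and the root. -/
noncomputable def depth (a : F.Idx) (x : F.Vert a) : ℕ := (F.graph a).dist x (F.root a)

/-- `y` is a child of `x`: a neighbour of `x` that is further away from the root. -/
def IsChild (a : F.Idx) (x y : F.Vert a) : Prop :=
  (F.graph a).Adj x y ∧ F.depth a x < F.depth a y

/-- A leaf is a vertex without children. (The vertex of a one-vertex tree is a leaf.) -/
def IsLeaf (a : F.Idx) (x : F.Vert a) : Prop := ∀ y, ¬ F.IsChild a x y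

/-- `y` belongs to the subtree rooted at `x`, i.e. `y` is reached from `x` by successively
passing to children (`x` itself included). -/
def IsDescendant (a : F.Idx) (x y : F.Vert a) : Prop :=
  Relation.ReflTransGen (F.IsChild a) x y

/-- The number of vertices of the subtree rooted at `x`. -/
noncomputable def subtreeSize (a : F.Idx) (x : F.Vert a) : ℕ :=
  Nat.card {y : F.Vert a // F.IsDescendant a x y}

/-- A member of the family with a marked vertex. -/
structure Pointed where
  tree : F.Idx
  vertex : F.Vert tree

/-- An ordered pair of a member of the family with a marked leaf and a member of the family. -/
structure GraftPair where
  stock : F.Idx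
  leaf : F.Vert stock
  isLeaf : F.IsLeaf stock leaf
  scion : F.Idx

variable {F}

/-- Data exhibiting the underlying rooted tree of `q.tree` as the result of grafting: the marked
leaf of `p.stock` is removed and `p.scion` is placed there as a subtree, `q.vertex` being
the vertex at which this happens. -/
structure GraftMaps (p : F.GraftPair) (q : F.Pointed) where
  /-- inclusion of the tree with the marked leaf -/
  upper : F.Vert p.stock ↪ F.Vert q.tree
  /-- inclusion of the grafted tree -/
  lower : F.Vert p.scion ↪ F.Vert q.tree
  upper_root : upper (F.root p.stock) = F.root q.tree
  upper_leaf : upper p.leaf = q.vertex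
  lower_root : lower (F.root p.scion) = q.vertex
  cover : Set.range upper ∪ Set.range lower = Set.univ
  overlap : Set.range upper ∩ Set.range lower = {q.vertex}
  graph_eq : F.graph q.tree = (F.graph p.stock).map upper ⊔ (F.graph p.scion).map lower

variable (F)

/-- A family is graftable if grafting is a bijection from the ordered pairs of a member with a
marked leaf and a member onto the members with a marked vertex. -/
def Graftable : Prop :=
  ∃ g : F.GraftPair → F.Pointed,
    (∀ p, Nonempty (GraftMaps p (g p))) ∧ Function.Bijective g

/-- The generating function `∑ₐ c(a) ω(|a|) x^|a|`, summed over the members `a` of the family. -/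
noncomputable def genFun (ω : ℕ → ℚ) (c : F.Idx → ℚ) : ℚ⟦X⟧ :=
  PowerSeries.mk fun n => ω n * ∑ a ∈ (F.finite_size n).toFinset, c a

/-- `T(x)`, the generating function for the number of trees. -/
noncomputable def treeGF (ω : ℕ → ℚ) : ℚ⟦X⟧ := F.genFun ω fun _ => 1

/-- `V(x)`, the generating function for the number of vertices. -/
noncomputable def vertexGF (ω : ℕ → ℚ) : ℚ⟦X⟧ := F.genFun ω fun a => (F.size a : ℚ)

/-- `L(x)`, the generating function for the number of leaves. -/
noncomputable def leafGF (ω : ℕ → ℚ) : ℚ⟦X⟧ :=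
  F.genFun ω fun a => (Nat.card {x : F.Vert a // F.IsLeaf a x} : ℚ)

/-- `D_k(x)`, the generating function of the sum over all trees and all vertices of the `k`-th
power of the distance from the vertex to the root. -/
noncomputable def momentGF (ω : ℕ → ℚ) (k : ℕ) : ℚ⟦X⟧ :=
  F.genFun ω fun a => ∑ x : F.Vert a, (F.depth a x : ℚ) ^ k

end TreeFamily

/-- The weight of ordinary generating functions. -/
def ordinary : ℕ → ℚ := fun _ => 1

/-- The weight of exponential generating functions. -/
def exponential : ℕ → ℚ := fun n => (n.factorial : ℚ)⁻¹

/-- `f(x) / x` for a power series `f` with constant term `0`. -/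
noncomputable def PowerSeries.quotX (f : ℚ⟦X⟧) : ℚ⟦X⟧ :=
  PowerSeries.mk fun n => PowerSeries.coeff (n + 1) f

theorem PowerSeries.X_mul_quotX (f : ℚ⟦X⟧) (hf : PowerSeries.constantCoeff f = 0) :
    PowerSeries.X * PowerSeries.quotX f = f := by
  ext n
  cases n with
  | zero => simp [hf]
  | succ n => simp [PowerSeries.quotX, PowerSeries.coeff_succ_X_mul]

/-- A family of labelled trees: the `n` vertices of a member carry the labels `0, …, n - 1`. -/
structure LabelledTreeFamily extends TreeFamily.{u, v} where
  label : ∀ a, Vert a ≃ Fin (Fintype.card (Vert a))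

namespace LabelledTreeFamily

variable (F : LabelledTreeFamily.{u, v})

/-- An ordered triplet of a tree with a marked leaf, a tree, and a subset of the labels of the
grafted tree, to be used in the subtree. -/
structure GraftTriple extends F.GraftPair where
  labels : Finset ℕ
  labels_mem : labels ∈
    (Finset.range (F.size stock + F.size scion - 1)).powersetCard (F.size scion)

variable {F}

/-- `q.tree` with its labels is the result of grafting: the grafted subtree uses exactly the labels
in `p.labels`, and the relative order of the labels is kept in either part (the label of the
marked leaf, which is removed, is dropped). -/
def IsLabelledGraft (p : F.GraftTriple) (q : F.Pointed) : Prop :=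
  ∃ m : TreeFamily.GraftMaps p.toGraftPair q,
    (Set.range fun y => (F.label q.tree (m.lower y) : ℕ)) = (p.labels : Set ℕ) ∧
    (∀ y y', F.label p.scion y < F.label p.scion y' ↔
      F.label q.tree (m.lower y) < F.label q.tree (m.lower y')) ∧
    (∀ x x', x ≠ p.leaf → x' ≠ p.leaf →
      (F.label p.stock x < F.label p.stock x' ↔
        F.label q.tree (m.upper x) < F.label q.tree (m.upper x')))

variable (F)

/-- A labelled family is graftable if grafting is a bijective correspondence between the triplets
and the members with a marked vertex, up to the label of the removed leaf: a member with a
marked vertex arises exactly once for each of the possible labels `i` that the leaf which replaces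
the removed subtree can receive. -/
def Graftable : Prop :=
  ∃ g : F.GraftTriple → F.Pointed,
    (∀ p, IsLabelledGraft p (g p)) ∧
    ∀ (q : F.Pointed) (i : ℕ), i < F.size q.tree - F.subtreeSize q.tree q.vertex + 1 →
      ∃! p : F.GraftTriple, g p = q ∧ (F.label p.stock p.leaf : ℕ) = i

end LabelledTreeFamily

/-! Write Y = L/x. Cutting a tree at a marked vertex leaves a stock with a marked leaf and the
subtree that hung there, so weighting each marked vertex by a statistic f of its subtree gives Y
times the generating function of f. This is `SubtreeFactorization`, proved from the grafting
bijection in the ordinary case and from a fibre count in the labelled one.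

With f = 1 it gives V = Y T. Iterating it (`chainGF_succ`), the sum of C(d + j, j) over all
vertices, d being the depth, has generating function Y^(j+1) T. By Pascal's rule the rising
factorial d(d+1)...(d+j-1) contributes j! Y^j (V - T) for j ≥ 1. Expanding d^k in rising factorials
yields P_k = ∑ⱼ (-1)^(k+j) j! S(k,j) y^j; its top coefficients come from S(k,k) = 1, S(k,k-1) =
C(k,2) and S(k,k-2) > 0 for k ≥ 3. -/

/-! ### Paths and distances in trees. -/

theorem SimpleGraph.IsTree.length_eq_dist {V : Type*} {G : SimpleGraph V} (hG : G.IsTree)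
    {x y : V} {p : G.Walk x y} (hp : p.IsPath) : p.length = G.dist x y := by
  obtain ⟨q, hq, hl⟩ := hG.connected.exists_path_of_dist x y
  rw [← hl, (hG.existsUnique_path x y).unique hp hq]

/-- The closer neighbour (relative to a fixed vertex) of a vertex of a tree is unique. -/
theorem SimpleGraph.IsTree.eq_of_adj_of_dist_lt {V : Type*} {G : SimpleGraph V} (hG : G.IsTree)
    {r x y w : V} (hx : G.Adj x w) (hxw : G.dist x r < G.dist w r)
    (hy : G.Adj y w) (hyw : G.dist y r < G.dist w r) : x = y := by
  classical
  -- A geodesic from a closer neighbour avoids `w`, so it extends to a path from `w`; uniqueness of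
  -- that path forces equal second vertices.
  have key : ∀ z, G.Adj z w → G.dist z r < G.dist w r →
      ∃ (h : G.Adj w z) (p : G.Walk z r), (SimpleGraph.Walk.cons h p).IsPath := by
    intro z hz hzw
    obtain ⟨p, hp, hl⟩ := hG.connected.exists_path_of_dist z r
    refine ⟨hz.symm, p, (SimpleGraph.Walk.cons_isPath_iff _ _).2 ⟨hp, fun hmem => ?_⟩⟩
    have h1 := SimpleGraph.dist_le (p.dropUntil w hmem)
    have h2 := p.length_dropUntil_le_length hmem
    omega
  obtain ⟨h1, p, hp⟩ := key x hx hxw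
  obtain ⟨h2, q, hq⟩ := key y hy hyw
  have := (hG.existsUnique_path w r).unique hp hq
  simp only [SimpleGraph.Walk.cons.injEq] at this
  exact this.1

theorem SimpleGraph.Walk.IsPath.append_of_disjoint {V : Type*} {G : SimpleGraph V} {x y z : V}
    {p : G.Walk x y} {q : G.Walk y z} (hp : p.IsPath) (hq : q.IsPath)
    (h : ∀ w, w ∈ p.support → w ∈ q.support → w = y) : (p.append q).IsPath := by
  rw [SimpleGraph.Walk.isPath_def, SimpleGraph.Walk.support_append, List.nodup_append]
  have hq' := hq.support_nodup
  rw [← SimpleGraph.Walk.cons_tail_support, List.nodup_cons] at hq'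
  refine ⟨hp.support_nodup, hq'.2, fun a ha b hb hab => ?_⟩
  subst hab
  have := h a ha (List.mem_of_mem_tail hb)
  subst this
  exact hq'.1 hb

/-! ### Depth, children and descendants in a rooted tree. -/

namespace TreeFamily

variable {F : TreeFamily.{u, v}}

@[simp] theorem depth_root (a : F.Idx) : F.depth a (F.root a) = 0 := SimpleGraph.dist_self

theorem depth_eq_zero {a : F.Idx} {x : F.Vert a} : F.depth a x = 0 ↔ x = F.root a :=
  (F.isTree a).connected.dist_eq_zero_iff

theorem IsChild.depth_eq {a : F.Idx} {x y : F.Vert a} (h : F.IsChild a x y) :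
    F.depth a y = F.depth a x + 1 := by
  refine le_antisymm ?_ h.2
  have := (F.isTree a).connected.dist_triangle (u := y) (v := x) (w := F.root a)
  rw [SimpleGraph.dist_eq_one_iff_adj.2 h.1.symm] at this
  unfold depth
  omega

theorem IsChild.unique {a : F.Idx} {x y w : F.Vert a} (hx : F.IsChild a x w)
    (hy : F.IsChild a y w) : x = y :=
  (F.isTree a).eq_of_adj_of_dist_lt hx.1 hx.2 hy.1 hy.2

theorem exists_isChild {a : F.Idx} {w : F.Vert a} (hw : w ≠ F.root a) :
    ∃ x, F.IsChild a x w := by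
  obtain ⟨p, hp⟩ := (F.isTree a).connected.exists_walk_length_eq_dist w (F.root a)
  cases p with
  | nil => exact absurd rfl hw
  | cons h p =>
    refine ⟨_, h.symm, ?_⟩
    have := SimpleGraph.dist_le p
    rw [SimpleGraph.Walk.length_cons] at hp
    unfold depth
    omega

theorem isDescendant_root (a : F.Idx) (w : F.Vert a) : F.IsDescendant a (F.root a) w := by
  induction hn : F.depth a w generalizing w with
  | zero => rw [depth_eq_zero.1 hn]; exact Relation.ReflTransGen.refl
  | succ n ih =>
    obtain ⟨x, hx⟩ := exists_isChild (w := w) (by rintro rfl; simp at hn)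
    exact (ih x (by have := hx.depth_eq; omega)).tail hx

theorem IsDescendant.depth_le {a : F.Idx} {x y : F.Vert a} (h : F.IsDescendant a x y) :
    F.depth a x ≤ F.depth a y := by
  induction h with
  | refl => rfl
  | tail _ h ih => exact ih.trans h.2.le

theorem IsChild.isDescendant_iff {a : F.Idx} {p w : F.Vert a} (hp : F.IsChild a p w)
    (v : F.Vert a) : F.IsDescendant a v w ↔ v = w ∨ F.IsDescendant a v p := by
  constructor
  · intro h
    rcases Relation.ReflTransGen.cases_tail h with h | ⟨z, hz, hzw⟩
    · exact Or.inl h.symm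
    · rw [← hzw.unique hp]
      exact Or.inr hz
  · rintro (rfl | h)
    · exact Relation.ReflTransGen.refl
    · exact h.tail hp

open Classical in
/-- A vertex has exactly one ancestor at each depth. -/
theorem sum_ancestors {M : Type*} [AddCommMonoid M] (a : F.Idx) (φ : ℕ → M) (w : F.Vert a) :
    ∑ v with F.IsDescendant a v w, φ (F.depth a w - F.depth a v) =
      ∑ i ∈ Finset.range (F.depth a w + 1), φ i := by
  induction hn : F.depth a w generalizing w φ with
  | zero =>
    have hw := depth_eq_zero.1 hn
    have hmem : w ∈ Finset.univ.filter fun v => F.IsDescendant a v w :=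
      Finset.mem_filter.2 ⟨Finset.mem_univ _, Relation.ReflTransGen.refl⟩
    rw [Finset.sum_eq_single_of_mem w hmem]
    · simp
    · intro b hb hbw
      have := (Finset.mem_filter.1 hb).2.depth_le
      exact absurd (by rw [hw]; exact depth_eq_zero.1 (by omega)) hbw
  | succ n ih =>
    obtain ⟨p, hp⟩ := exists_isChild (w := w) (by rintro rfl; simp at hn)
    have hpw := hp.depth_eq
    have hset : (Finset.univ.filter fun v => F.IsDescendant a v w) =
        insert w (Finset.univ.filter fun v => F.IsDescendant a v p) := by
      ext v
      simp [hp.isDescendant_iff]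
    have hnot : w ∉ Finset.univ.filter fun v => F.IsDescendant a v p := fun h => by
      have := (Finset.mem_filter.1 h).2.depth_le
      omega
    -- Seen from the parent `p`, every remaining depth difference drops by one, hence the induction
    -- for all `φ`, applied to its shift.
    rw [hset, Finset.sum_insert hnot, Finset.sum_range_succ',
      ← ih (fun i => φ (i + 1)) p (by omega), add_comm, hn]
    congr 1
    · refine Finset.sum_congr rfl fun v hv => ?_
      have := (Finset.mem_filter.1 hv).2.depth_le
      congr 1
      omega
    · simp

/-- Double counting of pairs of a vertex and a descendant. -/
theorem sum_sum_descendants {M : Type*} [AddCommMonoid M] (a : F.Idx) (φ : ℕ → M)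
    [∀ v, DecidablePred (F.IsDescendant a v)] :
    ∑ v, ∑ w with F.IsDescendant a v w, φ (F.depth a w - F.depth a v) =
      ∑ w, ∑ i ∈ Finset.range (F.depth a w + 1), φ i := by
  classical
  simp_rw [← sum_ancestors, Finset.sum_filter]
  rw [Finset.sum_comm]
  refine Finset.sum_congr rfl fun w _ => Finset.sum_congr rfl fun v _ => ?_
  congr

/-! ### Depths, subtrees and sizes under grafting. -/

namespace GraftMaps

variable {p : F.GraftPair} {q : F.Pointed} (m : GraftMaps p q)
include m

/-- The inclusion of the stock as a graph homomorphism. -/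
def upperHom : F.graph p.stock →g F.graph q.tree where
  toFun := m.upper
  map_rel' h := by
    rw [m.graph_eq]
    exact Or.inl (SimpleGraph.map_adj_apply.2 h)

/-- The inclusion of the scion as a graph homomorphism. -/
def lowerHom : F.graph p.scion →g F.graph q.tree where
  toFun := m.lower
  map_rel' h := by
    rw [m.graph_eq]
    exact Or.inr (SimpleGraph.map_adj_apply.2 h)

theorem eq_of_upper_eq_lower {x : F.Vert p.stock} {y : F.Vert p.scion}
    (h : m.upper x = m.lower y) : m.lower y = q.vertex := by
  have : m.lower y ∈ Set.range m.upper ∩ Set.range m.lower := ⟨⟨x, h⟩, ⟨y, rfl⟩⟩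
  rwa [m.overlap] at this

theorem depth_upper (x : F.Vert p.stock) :
    F.depth q.tree (m.upper x) = F.depth p.stock x := by
  obtain ⟨w, hw, hl⟩ := (F.isTree p.stock).connected.exists_path_of_dist x (F.root p.stock)
  have := (F.isTree q.tree).length_eq_dist
    (hw.map (f := m.upperHom) m.upper.injective)
  rw [SimpleGraph.Walk.length_map, hl] at this
  unfold depth
  rw [this, ← m.upper_root]
  rfl

/-- The path to the root of the scion and the path from the marked leaf to the root of the stock
meet only at `q.vertex`, so their concatenation is the unique path to the root. -/
theorem depth_lower (y : F.Vert p.scion) :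
    F.depth q.tree (m.lower y) = F.depth q.tree q.vertex + F.depth p.scion y := by
  obtain ⟨w, hw, hl⟩ := (F.isTree p.stock).connected.exists_path_of_dist p.leaf (F.root p.stock)
  obtain ⟨z, hz, hl'⟩ := (F.isTree p.scion).connected.exists_path_of_dist y (F.root p.scion)
  have hw' := hw.map (f := m.upperHom) m.upper.injective
  have hz' := hz.map (f := m.lowerHom) m.lower.injective
  have e : m.lowerHom (F.root p.scion) = m.upperHom p.leaf :=
    m.lower_root.trans m.upper_leaf.symm
  have hpath : ((z.map m.lowerHom).append ((w.map m.upperHom).copy e.symm rfl)).IsPath := by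
    refine hz'.append_of_disjoint (by simpa using hw') fun s hs hs' => ?_
    simp only [SimpleGraph.Walk.support_map, SimpleGraph.Walk.support_copy, List.mem_map]
      at hs hs'
    obtain ⟨b, -, rfl⟩ := hs
    obtain ⟨c, -, hc⟩ := hs'
    exact (m.eq_of_upper_eq_lower hc).trans m.lower_root.symm
  have := (F.isTree q.tree).length_eq_dist hpath
  simp only [SimpleGraph.Walk.length_append, SimpleGraph.Walk.length_copy,
    SimpleGraph.Walk.length_map] at this
  have h2 : F.depth q.tree q.vertex = F.depth p.stock p.leaf := by
    rw [← m.upper_leaf, m.depth_upper]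
  have h3 : F.depth q.tree (m.lower y) =
      (F.graph q.tree).dist (m.lowerHom y) (m.upperHom (F.root p.stock)) := by
    unfold depth
    rw [← m.upper_root]
    rfl
  rw [h2, h3, ← this, hl, hl']
  unfold depth
  omega

/-- A descent cannot leave the grafted part: an edge of the stock doing so would start at the marked
leaf and give it a child. -/
theorem mem_range_lower_iff (w : F.Vert q.tree) :
    w ∈ Set.range m.lower ↔ F.IsDescendant q.tree q.vertex w := by
  constructor
  · rintro ⟨y, rfl⟩
    rw [← m.lower_root]
    refine Relation.ReflTransGen.lift m.lower (fun b c hbc => ?_) _ _ (isDescendant_root p.scion y)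
    refine ⟨m.lowerHom.map_rel' hbc.1, ?_⟩
    rw [m.depth_lower, m.depth_lower]
    exact Nat.add_lt_add_left hbc.2 _
  · intro h
    induction h with
    | refl => exact ⟨_, m.lower_root⟩
    | @tail b c _ hbc ih =>
      obtain ⟨hadj, hlt⟩ := hbc
      rw [m.graph_eq, SimpleGraph.sup_adj, SimpleGraph.map_adj, SimpleGraph.map_adj] at hadj
      rcases hadj with ⟨s, t, hst, rfl, rfl⟩ | ⟨s, t, hst, rfl, rfl⟩
      · obtain ⟨y, hy⟩ := ih
        have hs : s = p.leaf := m.upper.injective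
          ((hy.symm.trans (m.eq_of_upper_eq_lower hy.symm)).trans m.upper_leaf.symm)
        subst hs
        refine absurd ⟨hst, ?_⟩ (p.isLeaf t)
        rwa [m.depth_upper, m.depth_upper] at hlt
      · exact ⟨t, rfl⟩

theorem size_add_one : F.size q.tree + 1 = F.size p.stock + F.size p.scion := by
  have h := Set.ncard_union_add_ncard_inter (Set.range m.upper) (Set.range m.lower)
  rw [m.cover, m.overlap, Set.ncard_univ, Set.ncard_singleton, Nat.card_eq_fintype_card,
    ← Set.image_univ, ← Set.image_univ, Set.ncard_image_of_injective _ m.upper.injective,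
    Set.ncard_image_of_injective _ m.lower.injective, Set.ncard_univ, Set.ncard_univ,
    Nat.card_eq_fintype_card, Nat.card_eq_fintype_card] at h
  exact h

theorem subtreeSize_eq : F.subtreeSize q.tree q.vertex = F.size p.scion := by
  unfold subtreeSize size
  rw [← Nat.card_eq_fintype_card]
  refine Nat.card_congr (Equiv.trans (Equiv.subtypeEquivRight fun w => ?_)
    (Equiv.ofInjective m.lower m.lower.injective).symm)
  exact (m.mem_range_lower_iff w).symm

theorem sum_descendants {M : Type*} [AddCommMonoid M] (φ : ℕ → M)
    [DecidablePred (F.IsDescendant q.tree q.vertex)] :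
    ∑ w with F.IsDescendant q.tree q.vertex w,
        φ (F.depth q.tree w - F.depth q.tree q.vertex) =
      ∑ y, φ (F.depth p.scion y) := by
  have : (Finset.univ.filter fun w => F.IsDescendant q.tree q.vertex w) =
      Finset.univ.map m.lower := by
    ext w
    simp [← m.mem_range_lower_iff]
  rw [this, Finset.sum_map]
  refine Finset.sum_congr rfl fun y _ => ?_
  rw [m.depth_lower, Nat.add_sub_cancel_left]

end GraftMaps

end TreeFamily

/-! ### Counting grafts, and the factorization for unlabelled families. -/

namespace TreeFamily

open Finset

variable {F : TreeFamily.{u, v}}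

theorem size_pos (a : F.Idx) : 0 < F.size a := Fintype.card_pos_iff.2 ⟨F.root a⟩

variable (F)

/-- The members with a marked vertex that have `n` vertices. -/
noncomputable def pointedOfSize (n : ℕ) : Finset F.Pointed :=
  ((F.finite_size n).toFinset.sigma fun _ => univ).map
    ⟨fun x => ⟨x.1, x.2⟩, fun x y h => by cases x; cases y; simpa using h⟩

open Classical in
/-- The pairs of a member with `i` vertices with a marked leaf and a member with `j` vertices. -/
noncomputable def graftPairsOfSizes (i j : ℕ) : Finset F.GraftPair :=
  (((F.finite_size i).toFinset.sigma fun s => (univ : Finset {x // F.IsLeaf s x})) ×ˢ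
    (F.finite_size j).toFinset).map
    ⟨fun x => ⟨x.1.1, x.1.2.1, x.1.2.2, x.2⟩, fun x y h => by
      obtain ⟨⟨s, l, hl⟩, w⟩ := x
      obtain ⟨⟨s', l', hl'⟩, w'⟩ := y
      simp only [GraftPair.mk.injEq] at h
      obtain ⟨rfl, h, rfl⟩ := h
      rw [heq_iff_eq] at h
      subst h
      rfl⟩

open Classical in
/-- The pairs of a member with a marked leaf and a member for which grafting gives a tree with
`n` vertices. -/
noncomputable def graftPairs (n : ℕ) : Finset F.GraftPair :=
  (antidiagonal n).biUnion fun x => F.graftPairsOfSizes (x.1 + 1) x.2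

variable {F}

theorem mem_pointedOfSize {n : ℕ} {q : F.Pointed} :
    q ∈ F.pointedOfSize n ↔ F.size q.tree = n := by
  simp only [pointedOfSize, mem_map, mem_sigma, Set.Finite.mem_toFinset, mem_univ, and_true]
  constructor
  · rintro ⟨x, hx, rfl⟩
    exact hx
  · intro h
    exact ⟨⟨q.tree, q.vertex⟩, h, rfl⟩

theorem mem_graftPairsOfSizes {i j : ℕ} {p : F.GraftPair} :
    p ∈ F.graftPairsOfSizes i j ↔ F.size p.stock = i ∧ F.size p.scion = j := by
  simp only [graftPairsOfSizes, mem_map, mem_product, mem_sigma, Set.Finite.mem_toFinset,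
    mem_univ, and_true]
  constructor
  · rintro ⟨x, hx, rfl⟩
    exact hx
  · intro h
    exact ⟨⟨⟨p.stock, p.leaf, p.isLeaf⟩, p.scion⟩, h, rfl⟩

theorem mem_graftPairs {n : ℕ} {p : F.GraftPair} :
    p ∈ F.graftPairs n ↔ F.size p.stock + F.size p.scion = n + 1 := by
  simp only [graftPairs, mem_biUnion, HasAntidiagonal.mem_antidiagonal, mem_graftPairsOfSizes]
  constructor
  · rintro ⟨x, hx, h1, h2⟩
    omega
  · intro h
    have := F.size_pos p.stock
    exact ⟨(F.size p.stock - 1, F.size p.scion), by simp; omega, by simp; omega, rfl⟩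

theorem sum_pointedOfSize {M : Type*} [AddCommMonoid M] (n : ℕ) (h : F.Pointed → M) :
    ∑ q ∈ F.pointedOfSize n, h q =
      ∑ a ∈ (F.finite_size n).toFinset, ∑ x : F.Vert a, h ⟨a, x⟩ := by
  rw [pointedOfSize, sum_map, sum_sigma]
  rfl

theorem sum_graftPairsOfSizes {i j : ℕ} (f : F.Idx → ℚ) :
    ∑ p ∈ F.graftPairsOfSizes i j, f p.scion =
      (∑ s ∈ (F.finite_size i).toFinset, (Nat.card {x : F.Vert s // F.IsLeaf s x} : ℚ)) *
        ∑ w ∈ (F.finite_size j).toFinset, f w := by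
  classical
  rw [graftPairsOfSizes, sum_map, sum_product, sum_mul, sum_sigma]
  refine sum_congr rfl fun s _ => ?_
  refine (sum_congr rfl fun l _ => (rfl : _ = ∑ w ∈ (F.finite_size j).toFinset, f w)).trans ?_
  rw [sum_const, nsmul_eq_mul, card_univ, Nat.card_eq_fintype_card]

theorem sum_graftPairs {M : Type*} [AddCommMonoid M] (n : ℕ) (f : F.GraftPair → M) :
    ∑ p ∈ F.graftPairs n, f p =
      ∑ x ∈ antidiagonal n, ∑ p ∈ F.graftPairsOfSizes (x.1 + 1) x.2, f p := by
  classical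
  rw [graftPairs, sum_biUnion]
  intro x _ y _ hxy
  refine disjoint_left.2 fun p hp hp' => hxy ?_
  rw [mem_graftPairsOfSizes] at hp hp'
  exact Prod.ext (by omega) (by omega)

/-- Division by x accounts for the removed leaf: the two sizes add up to n + 1. -/
theorem coeff_quotX_leafGF_mul (ω : ℕ → ℚ) (f : F.Idx → ℚ) (n : ℕ) :
    PowerSeries.coeff n ((F.leafGF ω).quotX * F.genFun ω f) =
      ∑ p ∈ F.graftPairs n, ω (F.size p.stock) * ω (F.size p.scion) * f p.scion := by
  rw [sum_graftPairs, PowerSeries.coeff_mul]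
  refine sum_congr rfl fun x _ => ?_
  simp only [PowerSeries.quotX, leafGF, genFun, PowerSeries.coeff_mk]
  rw [mul_mul_mul_comm, ← sum_graftPairsOfSizes, mul_sum]
  refine sum_congr rfl fun p hp => ?_
  rw [mem_graftPairsOfSizes] at hp
  rw [hp.1, hp.2]

variable (F)

/-- Marking a vertex of the members of the family and counting them by a function of
the subtree at this vertex multiplies the generating function by `L(x) / x`. -/
def SubtreeFactorization (ω : ℕ → ℚ) : Prop :=
  ∀ (f : F.Idx → ℚ) (h : ∀ a, F.Vert a → ℚ),
    (∀ p q, Nonempty (GraftMaps p q) → h q.tree q.vertex = f p.scion) →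
    F.genFun ω (fun a => ∑ x, h a x) = (F.leafGF ω).quotX * F.genFun ω f

variable {F}

theorem Graftable.subtreeFactorization (hF : F.Graftable) :
    F.SubtreeFactorization ordinary := by
  obtain ⟨g, hg, hbij⟩ := hF
  intro f h hfh
  ext n
  rw [coeff_quotX_leafGF_mul]
  simp only [genFun, PowerSeries.coeff_mk, ordinary, one_mul]
  rw [← sum_pointedOfSize n fun q => h q.tree q.vertex]
  symm
  refine sum_bij (fun p _ => g p) (fun p hp => ?_) (fun p _ p' _ e => hbij.1 e)
    (fun q hq => ?_) (fun p _ => (hfh p (g p) (hg p)).symm)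
  · obtain ⟨m⟩ := hg p
    have := m.size_add_one
    rw [mem_graftPairs] at hp
    rw [mem_pointedOfSize]
    omega
  · obtain ⟨p, rfl⟩ := hbij.2 q
    obtain ⟨m⟩ := hg p
    have := m.size_add_one
    rw [mem_pointedOfSize] at hq
    exact ⟨p, mem_graftPairs.2 (by omega), rfl⟩

end TreeFamily

/-! ### The factorization for labelled families. -/

namespace LabelledTreeFamily

open Finset

variable (F : LabelledTreeFamily.{u, v})

/-- The triplets for which grafting gives a tree with `n` vertices. -/
noncomputable def graftTriples (n : ℕ) : Finset F.GraftTriple :=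
  ((F.graftPairs n).sigma fun p =>
    ((range (F.size p.stock + F.size p.scion - 1)).powersetCard (F.size p.scion)).attach).map
    ⟨fun x => ⟨x.1, x.2.1, x.2.2⟩, fun x y h => by
      obtain ⟨p, W, hW⟩ := x
      obtain ⟨p', W', hW'⟩ := y
      simp only [GraftTriple.mk.injEq] at h
      obtain ⟨rfl, rfl⟩ := h
      rfl⟩

variable {F}

theorem mem_graftTriples {n : ℕ} {p : F.GraftTriple} :
    p ∈ F.graftTriples n ↔ F.size p.stock + F.size p.scion = n + 1 := by
  simp only [graftTriples, mem_map, mem_sigma, mem_attach, and_true, TreeFamily.mem_graftPairs]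
  constructor
  · rintro ⟨x, hx, rfl⟩
    exact hx
  · intro h
    exact ⟨⟨p.toGraftPair, p.labels, p.labels_mem⟩, h, rfl⟩

theorem sum_graftTriples (n : ℕ) (f : F.GraftPair → ℚ) :
    ∑ p ∈ F.graftTriples n, f p.toGraftPair =
      ∑ p ∈ F.graftPairs n, (n.choose (F.size p.scion) : ℚ) * f p := by
  rw [graftTriples, sum_map, sum_sigma]
  refine sum_congr rfl fun p hp => ?_
  rw [TreeFamily.mem_graftPairs] at hp
  have : F.size p.stock + F.size p.scion - 1 = n := by omega
  refine (sum_congr rfl fun W _ => (rfl : _ = f p)).trans ?_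
  rw [sum_const, nsmul_eq_mul, card_attach, card_powersetCard, card_range, this]

theorem Graftable.subtreeFactorization (hF : F.Graftable) :
    F.SubtreeFactorization exponential := by
  classical
  obtain ⟨g, hg, hu⟩ := hF
  intro f h hfh
  have hmaps : ∀ n, ∀ p : F.GraftTriple, p ∈ F.graftTriples n ↔ g p ∈ F.pointedOfSize n := by
    intro n p
    obtain ⟨m, -⟩ := hg p
    have := m.size_add_one
    rw [mem_graftTriples, TreeFamily.mem_pointedOfSize]
    omega
  have hsize : ∀ p : F.GraftTriple,
      F.size (g p).tree - F.subtreeSize (g p).tree (g p).vertex + 1 = F.size p.stock := by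
    intro p
    obtain ⟨m, -⟩ := hg p
    have := m.size_add_one
    have := F.size_pos p.stock
    rw [m.subtreeSize_eq]
    omega
  -- The label of the removed leaf enumerates the fibre, whose cardinality is therefore the size of
  -- the stock; dividing by it below makes every marked tree count once.
  have hfiber : ∀ n, ∀ q ∈ F.pointedOfSize n, ((F.graftTriples n).filter fun p => g p = q).card =
      F.size q.tree - F.subtreeSize q.tree q.vertex + 1 := by
    intro n q hq
    rw [← card_range (_ + 1)]
    refine card_bij (fun p _ => (F.label p.stock p.leaf : ℕ)) (fun p hp => ?_)
      (fun p hp p' hp' e => ?_) (fun i hi => ?_)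
    · rw [mem_range, ← (mem_filter.1 hp).2, hsize]
      exact (F.label p.stock p.leaf).2
    · have e1 := (mem_filter.1 hp).2
      have e2 := (mem_filter.1 hp').2
      refine (hu q _ ?_).unique ⟨e1, rfl⟩ ⟨e2, e.symm⟩
      rw [← e1, hsize]
      exact (F.label p.stock p.leaf).2
    · obtain ⟨p, ⟨hp, hi⟩, -⟩ := hu q i (mem_range.1 hi)
      exact ⟨p, mem_filter.2 ⟨(hmaps n p).2 (hp ▸ hq), hp⟩, hi⟩
  ext n
  rw [TreeFamily.coeff_quotX_leafGF_mul]
  simp only [TreeFamily.genFun, PowerSeries.coeff_mk]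
  rw [← TreeFamily.sum_pointedOfSize n fun q => h q.tree q.vertex]
  calc exponential n * ∑ q ∈ F.pointedOfSize n, h q.tree q.vertex
      = exponential n * ∑ q ∈ F.pointedOfSize n, ∑ p ∈ F.graftTriples n with g p = q,
          (F.size p.stock : ℚ)⁻¹ * f p.scion := by
        congr 1
        refine sum_congr rfl fun q hq => ?_
        have : ∀ p ∈ (F.graftTriples n).filter (fun p => g p = q),
            (F.size p.stock : ℚ)⁻¹ * f p.scion =
              ((F.size q.tree - F.subtreeSize q.tree q.vertex + 1 : ℕ) : ℚ)⁻¹ *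
                h q.tree q.vertex := by
          intro p hp
          obtain ⟨-, rfl⟩ := mem_filter.1 hp
          obtain ⟨m, -⟩ := hg p
          rw [hsize, hfh _ _ ⟨m⟩]
        rw [sum_congr rfl this, sum_const, hfiber n q hq, nsmul_eq_mul,
          mul_inv_cancel_left₀ (by positivity)]
    _ = exponential n * ∑ p ∈ F.graftTriples n, (F.size p.stock : ℚ)⁻¹ * f p.scion := by
        rw [sum_fiberwise_of_maps_to fun p hp => (hmaps n p).1 hp]
    _ = ∑ p ∈ F.graftPairs n,
          exponential (F.size p.stock) * exponential (F.size p.scion) * f p.scion := by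
        rw [sum_graftTriples n fun p => (F.size p.stock : ℚ)⁻¹ * f p.scion, mul_sum]
        refine sum_congr rfl fun p hp => ?_
        rw [TreeFamily.mem_graftPairs] at hp
        -- With stock size s + 1, scion size u and n = s + u, the weights agree: C(n, u) / (n! (s +
        -- 1)) = 1 / ((s + 1)! u!).
        obtain ⟨s, hs⟩ := Nat.exists_eq_succ_of_ne_zero (F.size_pos p.stock).ne'
        have hn : n = s + F.size p.scion := by omega
        rw [hs, hn, Nat.add_choose, exponential, exponential, exponential, Nat.factorial_succ,
          Nat.cast_div (Nat.factorial_mul_factorial_dvd_factorial_add _ _) (by positivity)]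
        push_cast
        field_simp

end LabelledTreeFamily

/-! ### Stirling numbers and the polynomials P_k, Q_k. -/

theorem Nat.stirlingSecond_pos {n k : ℕ} (hk : 1 ≤ k) (hkn : k ≤ n) :
    0 < Nat.stirlingSecond n k := by
  induction n generalizing k with
  | zero => omega
  | succ n ih =>
    obtain ⟨k, rfl⟩ := Nat.exists_eq_succ_of_ne_zero (by omega : k ≠ 0)
    rw [Nat.succ_eq_add_one, Nat.stirlingSecond_succ_succ]
    rcases Nat.lt_or_ge k n with h | h
    · have := ih (k := k + 1) (by omega) (by omega)
      positivity
    · obtain rfl : k = n := by omega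
      simp [Nat.stirlingSecond_self]

/-- Powers in terms of rising factorials. -/
theorem pow_eq_sum_stirlingSecond_mul_ascFactorial (d k : ℕ) :
    (d : ℚ) ^ k = ∑ j ∈ Finset.range (k + 1),
      (-1) ^ (k + j) * (Nat.stirlingSecond k j : ℚ) * (d.ascFactorial j : ℚ) := by
  induction k with
  | zero => simp
  | succ k ih =>
    have hstep : ∀ j : ℕ, (d : ℚ) * (d.ascFactorial j : ℚ) =
        (d.ascFactorial (j + 1) : ℚ) - j * (d.ascFactorial j : ℚ) := by
      intro j
      rw [Nat.ascFactorial_succ]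
      push_cast
      ring
    rw [pow_succ', ih, Finset.mul_sum, Finset.sum_range_succ' _ (k + 1)]
    -- Shifting j costs nothing: the term j = 0 has the factor j, and the added top term has S(k,
    -- k+1) = 0.
    have hlast : ∑ j ∈ Finset.range (k + 1), (-1 : ℚ) ^ (k + j) * (Nat.stirlingSecond k j : ℚ) *
          (j * (d.ascFactorial j : ℚ)) =
        ∑ j ∈ Finset.range (k + 1), (-1 : ℚ) ^ (k + (j + 1)) *
          (Nat.stirlingSecond k (j + 1) : ℚ) *
          ((j + 1 : ℕ) * (d.ascFactorial (j + 1) : ℚ)) := by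
      rw [Finset.sum_range_succ', Finset.sum_range_succ _ k,
        Nat.stirlingSecond_eq_zero_of_lt (Nat.lt_succ_self k)]
      simp
    calc ∑ j ∈ Finset.range (k + 1), (d : ℚ) * ((-1) ^ (k + j) *
          (Nat.stirlingSecond k j : ℚ) * (d.ascFactorial j : ℚ))
        = ∑ j ∈ Finset.range (k + 1), (-1 : ℚ) ^ (k + j) * (Nat.stirlingSecond k j : ℚ) *
            (d.ascFactorial (j + 1) : ℚ) -
          ∑ j ∈ Finset.range (k + 1), (-1 : ℚ) ^ (k + j) * (Nat.stirlingSecond k j : ℚ) *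
            (j * (d.ascFactorial j : ℚ)) := by
          rw [← Finset.sum_sub_distrib]
          refine Finset.sum_congr rfl fun j _ => ?_
          linear_combination (-1) ^ (k + j) * (Nat.stirlingSecond k j : ℚ) * hstep j
      _ = _ := by
          rw [hlast, ← Finset.sum_sub_distrib]
          simp only [Nat.stirlingSecond_succ_zero, Nat.cast_zero, mul_zero, zero_mul, add_zero]
          refine Finset.sum_congr rfl fun j _ => ?_
          rw [Nat.stirlingSecond_succ_succ]
          push_cast
          ring

/-- The polynomials `∑ⱼ (-1)^(k+j) j! S(k, j) yʲ` with Stirling numbers of the second kind. -/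
noncomputable def depthPolynomial (k : ℕ) : Polynomial ℚ :=
  ∑ j ∈ Finset.range (k + 1),
    Polynomial.C ((-1) ^ (k + j) * (Nat.stirlingSecond k j : ℚ) * (j.factorial : ℚ)) *
      Polynomial.X ^ j

theorem coeff_depthPolynomial (k j : ℕ) : (depthPolynomial k).coeff j =
    (-1) ^ (k + j) * (Nat.stirlingSecond k j : ℚ) * (j.factorial : ℚ) := by
  simp only [depthPolynomial, Polynomial.finsetSum_coeff, Polynomial.coeff_C_mul_X_pow,
    Finset.sum_ite_eq, Finset.mem_range]
  split_ifs with h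
  · rfl
  · rw [Nat.stirlingSecond_eq_zero_of_lt (by omega)]
    simp

/-- What remains of `depthPolynomial k` after its two leading terms have been removed. -/
noncomputable def depthRemainder (k : ℕ) : Polynomial ℚ :=
  depthPolynomial k - Polynomial.C (k.factorial : ℚ) * Polynomial.X ^ k
    + Polynomial.C ((k.factorial : ℚ) * ((k : ℚ) - 1) / 2) * Polynomial.X ^ (k - 1)

/-- The two top coefficients cancel because S(n+1, n+1) = 1 and n! C(n+1, 2) = (n+1)! n / 2. -/
theorem coeff_depthRemainder_succ (n j : ℕ) : (depthRemainder (n + 1)).coeff j =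
    if j < n then (depthPolynomial (n + 1)).coeff j else 0 := by
  simp only [depthRemainder, Polynomial.coeff_add, Polynomial.coeff_sub,
    Polynomial.coeff_C_mul_X_pow, Nat.add_sub_cancel]
  rcases lt_trichotomy j n with h | rfl | h
  · rw [if_neg (by omega), if_neg (by omega), if_pos h]
    ring
  · rw [if_neg (by omega), if_pos rfl, if_neg (lt_irrefl _), coeff_depthPolynomial,
      Nat.stirlingSecond_succ_self_left, Nat.cast_choose_two, Nat.factorial_succ,
      show j + 1 + j = 2 * j + 1 by ring, pow_succ, pow_mul]
    push_cast
    ring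
  · rw [if_neg (by omega : ¬ j < n), if_neg (by omega : ¬ j = n), coeff_depthPolynomial]
    split_ifs with h'
    · subst h'
      rw [Nat.stirlingSecond_self, show n + 1 + (n + 1) = 2 * (n + 1) by ring, pow_mul]
      simp
    · rw [Nat.stirlingSecond_eq_zero_of_lt (by omega)]
      simp

theorem natDegree_depthRemainder {k : ℕ} (hk : 2 ≤ k) :
    (depthRemainder k).natDegree = k - 2 := by
  obtain ⟨n, rfl⟩ : ∃ n, k = n + 2 := ⟨k - 2, by omega⟩
  rw [Nat.add_sub_cancel]
  have hle : (depthRemainder (n + 2)).natDegree ≤ n := by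
    rw [Polynomial.natDegree_le_iff_coeff_eq_zero]
    intro N hN
    rw [coeff_depthRemainder_succ, if_neg (by omega)]
  -- For k = 2 the constant coefficient vanishes, as S(2,0) = 0, so only the degree bound is
  -- available.
  rcases Nat.eq_zero_or_pos n with rfl | hn
  · exact Nat.le_zero.1 hle
  · refine Polynomial.natDegree_eq_of_le_of_coeff_ne_zero hle ?_
    rw [coeff_depthRemainder_succ, if_pos (by omega), coeff_depthPolynomial]
    have h1 := (Nat.stirlingSecond_pos hn (show n ≤ n + 2 by omega)).ne'
    have h2 := n.factorial_ne_zero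
    simp [h1, h2]

theorem depthRemainder_one : depthRemainder 1 = 0 := by
  ext j
  rw [coeff_depthRemainder_succ, if_neg (by omega), Polynomial.coeff_zero]

/-! ### Generating functions of chains and of moments. -/

namespace TreeFamily

variable {F : TreeFamily.{u, v}} {ω : ℕ → ℚ}

theorem genFun_sub (f g : F.Idx → ℚ) :
    F.genFun ω (fun a => f a - g a) = F.genFun ω f - F.genFun ω g := by
  ext n
  simp [genFun, mul_sub]

theorem genFun_sum_smul {ι : Type*} (s : Finset ι) (c : ι → ℚ) (f : ι → F.Idx → ℚ) :
    F.genFun ω (fun a => ∑ j ∈ s, c j * f j a) = ∑ j ∈ s, PowerSeries.C (c j) * F.genFun ω (f j) := by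
  ext n
  simp only [genFun, PowerSeries.coeff_mk, map_sum, PowerSeries.coeff_C_mul]
  rw [Finset.sum_comm, Finset.mul_sum]
  refine Finset.sum_congr rfl fun j _ => ?_
  rw [← Finset.mul_sum]
  ring

/-- The generating function of `∑ₓ C(d(x) + j, j)`, which counts weakly descending chains of
`j + 1` vertices. -/
noncomputable def chainGF (F : TreeFamily.{u, v}) (ω : ℕ → ℚ) (j : ℕ) : ℚ⟦X⟧ :=
  F.genFun ω fun a => ∑ x : F.Vert a, ((F.depth a x + j).choose j : ℚ)

theorem chainGF_zero : F.chainGF ω 0 = F.vertexGF ω := by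
  simp [chainGF, vertexGF, size]

theorem momentGF_zero_sub :
    F.momentGF ω 0 - F.treeGF ω = (F.vertexGF ω - F.treeGF ω) *
      Polynomial.aeval (F.leafGF ω).quotX (depthPolynomial 0) := by
  simp [momentGF, vertexGF, size, depthPolynomial]

namespace SubtreeFactorization

variable (hF : F.SubtreeFactorization ω)
include hF

theorem vertexGF_eq : F.vertexGF ω = (F.leafGF ω).quotX * F.treeGF ω := by
  have := hF (fun _ => 1) (fun _ _ => 1) (fun _ _ _ => rfl)
  simpa [vertexGF, treeGF, size] using this

/-- Mark the top vertex of a chain: the rest is a chain in its subtree. Exchanging the two sums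
turns this into the hockey-stick identity along the ancestors. -/
theorem chainGF_succ (j : ℕ) :
    F.chainGF ω (j + 1) = (F.leafGF ω).quotX * F.chainGF ω j := by
  classical
  rw [chainGF, chainGF, ← hF _ (fun a v => ∑ w with F.IsDescendant a v w,
    ((F.depth a w - F.depth a v + j).choose j : ℚ))]
  · congr 1
    funext a
    rw [sum_sum_descendants a fun i => ((i + j).choose j : ℚ)]
    refine Finset.sum_congr rfl fun x _ => ?_
    rw [← Nat.cast_sum, Nat.sum_range_add_choose]
    congr 2
  · rintro p q ⟨m⟩
    exact m.sum_descendants fun i => ((i + j).choose j : ℚ)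

theorem chainGF_eq (j : ℕ) :
    F.chainGF ω j = (F.leafGF ω).quotX ^ (j + 1) * F.treeGF ω := by
  induction j with
  | zero => rw [chainGF_zero, hF.vertexGF_eq, pow_one]
  | succ j ih =>
    rw [hF.chainGF_succ, ih]
    ring

/-- Pascal's rule C(d+j, j+1) = C(d+j+1, j+1) - C(d+j, j) makes this a difference of consecutive
chain functions, and V = Y T extracts the factor V - T. -/
theorem genFun_ascFactorial (j : ℕ) :
    F.genFun ω (fun a => ∑ x : F.Vert a, ((F.depth a x).ascFactorial (j + 1) : ℚ)) =
      PowerSeries.C ((j + 1).factorial : ℚ) *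
        ((F.vertexGF ω - F.treeGF ω) * (F.leafGF ω).quotX ^ (j + 1)) := by
  have h : (F.vertexGF ω - F.treeGF ω) * (F.leafGF ω).quotX ^ (j + 1) =
      F.chainGF ω (j + 1) - F.chainGF ω j := by
    rw [hF.chainGF_eq, hF.chainGF_eq, hF.vertexGF_eq]
    ring
  rw [h, chainGF, chainGF, ← genFun_sub]
  ext n
  simp only [genFun, PowerSeries.coeff_mk, PowerSeries.coeff_C_mul, Finset.mul_sum]
  refine Finset.sum_congr rfl fun a _ => ?_
  rw [← Finset.sum_sub_distrib, Finset.mul_sum, Finset.mul_sum]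
  refine Finset.sum_congr rfl fun x _ => ?_
  have hasc : ((F.depth a x).ascFactorial (j + 1) : ℚ) =
      ((j + 1).factorial : ℚ) * ((F.depth a x + j).choose (j + 1) : ℚ) := by
    rw [Nat.ascFactorial_eq_factorial_mul_choose']
    push_cast
    rfl
  rw [hasc, ← add_assoc, Nat.choose_succ_succ']
  push_cast
  ring

theorem momentGF_eq {k : ℕ} (hk : 1 ≤ k) :
    F.momentGF ω k = (F.vertexGF ω - F.treeGF ω) *
      Polynomial.aeval (F.leafGF ω).quotX (depthPolynomial k) := by
  obtain ⟨k, rfl⟩ : ∃ n, k = n + 1 := ⟨k - 1, by omega⟩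
  have hm : F.momentGF ω (k + 1) = F.genFun ω fun a =>
      ∑ j ∈ Finset.range (k + 2), ((-1) ^ (k + 1 + j) * (Nat.stirlingSecond (k + 1) j : ℚ)) *
        ∑ x : F.Vert a, ((F.depth a x).ascFactorial j : ℚ) := by
    unfold momentGF
    congr 1
    funext a
    simp_rw [pow_eq_sum_stirlingSecond_mul_ascFactorial, Finset.mul_sum]
    exact Finset.sum_comm
  rw [hm, genFun_sum_smul, depthPolynomial, map_sum, Finset.mul_sum]
  refine Finset.sum_congr rfl fun j _ => ?_
  -- The term j = 0 drops out since S(k+1, 0) = 0; this is where a positive exponent matters.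
  rcases j with _ | j
  · simp
  · have haeval : ∀ (c : ℚ) (n : ℕ) (y : ℚ⟦X⟧), Polynomial.aeval y
        (Polynomial.C c * Polynomial.X ^ n) = PowerSeries.C c * y ^ n := fun c n y => by
      rw [map_mul, map_pow, Polynomial.aeval_X, Polynomial.aeval_C,
        PowerSeries.algebraMap_apply, Algebra.algebraMap_self, RingHom.id_apply]
    rw [hF.genFun_ascFactorial, haeval, map_mul PowerSeries.C _ ((j + 1).factorial : ℚ)]
    ring

end SubtreeFactorization

end TreeFamily

theorem theorem2p2 :
    ∃ P Q : ℕ → Polynomial ℚ,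
      (P 0 = 1 ∧ Q 0 = 0 ∧ Q 1 = 0) ∧
      (∀ k : ℕ, 1 ≤ k →
        P k = Polynomial.C (k.factorial : ℚ) * Polynomial.X ^ k
          - Polynomial.C ((k.factorial : ℚ) * ((k : ℚ) - 1) / 2) * Polynomial.X ^ (k - 1) + Q k) ∧
      (∀ k : ℕ, 2 ≤ k → (Q k).natDegree = k - 2) ∧
      -- families of trees, with ordinary generating functions
      (∀ (F : TreeFamily.{u, v}) (Φ : PowerSeries ℚ),
        F.Graftable →
        F.treeGF ordinary = PowerSeries.X * Φ.subst (F.treeGF ordinary) →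
        (∀ k : ℕ, 1 ≤ k →
          F.momentGF ordinary k = (F.vertexGF ordinary - F.treeGF ordinary) *
            Polynomial.aeval (F.leafGF ordinary).quotX (P k)) ∧
        -- for `k = 0` the roots, for which `d ^ k = 0 ^ 0 = 1`, are not counted
        F.momentGF ordinary 0 - F.treeGF ordinary =
          (F.vertexGF ordinary - F.treeGF ordinary) *
            Polynomial.aeval (F.leafGF ordinary).quotX (P 0)) ∧
      -- families of labelled trees, with exponential generating functions
      (∀ (F : LabelledTreeFamily.{u, v}) (Φ : PowerSeries ℚ),
        F.Graftable →
        F.treeGF exponential = PowerSeries.X * Φ.subst (F.treeGF exponential) →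
        (∀ k : ℕ, 1 ≤ k →
          F.momentGF exponential k = (F.vertexGF exponential - F.treeGF exponential) *
            Polynomial.aeval (F.leafGF exponential).quotX (P k)) ∧
        F.momentGF exponential 0 - F.treeGF exponential =
          (F.vertexGF exponential - F.treeGF exponential) *
            Polynomial.aeval (F.leafGF exponential).quotX (P 0)) := by
  -- The case split is needed because truncated subtraction makes `depthRemainder 0` equal to -1/2.
  refine ⟨depthPolynomial, fun k => if k = 0 then 0 else depthRemainder k,
    ⟨by simp [depthPolynomial], if_pos rfl, ?_⟩, fun k hk => ?_, fun k hk => ?_,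
    fun F Φ hF _ => ?_, fun F Φ hF _ => ?_⟩
  · simp [depthRemainder_one]
  · beta_reduce
    rw [if_neg (by omega), depthRemainder]
    ring
  · beta_reduce
    rw [if_neg (by omega), natDegree_depthRemainder hk]
  · exact ⟨fun k hk => hF.subtreeFactorization.momentGF_eq hk,
      TreeFamily.momentGF_zero_sub⟩
  · exact ⟨fun k hk => hF.subtreeFactorization.momentGF_eq hk,
      TreeFamily.momentGF_zero_sub⟩
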